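/- Let $2\le n<\infty$ and let $\mathcal O_n$ be the Cuntz algebra, i.e. the universal unital $C^*$-algebra generated by $s_1,\dots,s_n$ subject to $s_i^*s_j=\delta_{ij}I$ and $\sum_{i=1}^n s_is_i^*=I$. For a word $J=(j_1,\dots,j_l)$ in $\{1,\dots,n\}$, $l\ge 0$, write $|J|=l$ and $s_J=s_{j_1}\cdots s_{j_l}$, with $s_\emptyset=I$. For a state $\omega$ on $\mathcal O_n$ with GNS representation $(\mathcal H,\pi,\Omega)$, let $\mathcal K(\omega)\subseteq\mathcal H$ be the closed linear span of the vectors $\pi(s_J)^*\Omega$ over all words $J$, and let $\mathrm{cdim}\,\omega=\dim\mathcal K(\omega)\in\{1,2,\dots,\infty\}$. Write $\omega'\sim\omega$ when the GNS representations of the states $\omega'$ and $\omega$ are unitarily equivalent, and put $$\kappa(\omega)=\min\{\mathrm{cdim}\,\omega' : \omega'\text{ a state on }\mathcal O_n,\ \omega'\sim\omega\}.$$ The state $\omega$ is called properly infinitely correlated if $\kappa(\omega)=\infty$. Let $z=(z^{(i)})_{i\ge1}$ be a sequence of unit vectors in $\mathbb C^n$, and put $z_J=z^{(1)}_{j_1}\cdots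 z^{(m)}_{j_m}$ for a word $J=(j_1,\dots,j_m)$ and $z_\emptyset=1$. The induced product state by $z$ is the state $\omega_z$ on $\mathcal O_n$ such that, for all words $J,K$, $$\omega_z(s_Js_K^*)=\begin{cases}\overline{z_J}\,z_K,&|J|=|K|,\\ 0,&\text{otherwise.}\end{cases}$$ **Proposition.** Every induced product state $\omega_z$ on $\mathcal O_n$ is properly infinitely correlated: $\kappa(\omega_z)=\infty$. -/

import Mathlib

noncomputable section

open scoped ComplexOrder

namespace Cuntz

/-! ### The free unital complex `*`-algebra on `n` letters -/

/-- The unital complex `*`-algebra of noncommutative polynomials in the letters `s i` and their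
formal adjoints; `Sum.inl i` is the letter `s i` and `Sum.inr i` is its adjoint. -/
def FreeStar (n : ℕ) : Type := FreeAlgebra ℂ (Fin n ⊕ Fin n)

variable {n : ℕ}

instance : Ring (FreeStar n) := inferInstanceAs (Ring (FreeAlgebra ℂ (Fin n ⊕ Fin n)))

instance : Algebra ℂ (FreeStar n) :=
  inferInstanceAs (Algebra ℂ (FreeAlgebra ℂ (Fin n ⊕ Fin n)))

namespace FreeStar

/-- A letter or the formal adjoint of a letter. -/
def letter (x : Fin n ⊕ Fin n) : FreeStar n := FreeAlgebra.ι ℂ x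

/-- The generator `s i` of the free `*`-algebra. -/
def gen (i : Fin n) : FreeStar n := letter (Sum.inl i)

@[elab_as_elim]
theorem induction {motive : FreeStar n → Prop}
    (scalar : ∀ r : ℂ, motive (algebraMap ℂ (FreeStar n) r))
    (letter : ∀ x, motive (letter x))
    (mul : ∀ a b, motive a → motive b → motive (a * b))
    (add : ∀ a b, motive a → motive b → motive (a + b)) (a : FreeStar n) : motive a :=
  FreeAlgebra.induction (R := ℂ) (X := Fin n ⊕ Fin n) (motive := motive)
    scalar letter mul add a

/-- The opposite of the free `*`-algebra, with scalars acting through complex conjugation. -/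
def ConjOp (n : ℕ) : Type := (FreeStar n)ᵐᵒᵖ

instance : Ring (ConjOp n) := inferInstanceAs (Ring (FreeStar n)ᵐᵒᵖ)

instance : Algebra ℂ (ConjOp n) :=
  RingHom.toAlgebra' ((algebraMap ℂ (FreeStar n)ᵐᵒᵖ).comp (starRingEnd ℂ))
    (fun c (x : (FreeStar n)ᵐᵒᵖ) => Algebra.commutes (starRingEnd ℂ c) x)

/-- The antilinear antimultiplicative involution that exchanges `s i` with its adjoint, as an
algebra homomorphism to the opposite algebra with conjugated scalars. -/
def starAux (n : ℕ) : FreeAlgebra ℂ (Fin n ⊕ Fin n) →ₐ[ℂ] ConjOp n :=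
  FreeAlgebra.lift ℂ (fun x => (MulOpposite.op (letter x.swap) : (FreeStar n)ᵐᵒᵖ))

/-- The same involution as a ring homomorphism to the opposite ring. -/
def starHom (n : ℕ) : FreeStar n →+* (FreeStar n)ᵐᵒᵖ := (starAux n).toRingHom

theorem starHom_letter (x : Fin n ⊕ Fin n) :
    starHom n (letter x) = MulOpposite.op (letter x.swap) :=
  FreeAlgebra.lift_ι_apply (A := ConjOp n) _ x

theorem starHom_scalar (r : ℂ) :
    starHom n (algebraMap ℂ (FreeStar n) r) =
      MulOpposite.op (algebraMap ℂ (FreeStar n) (star r)) :=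
  (starAux n).commutes r

instance : StarRing (FreeStar n) where
  star x := (starHom n x).unop
  star_involutive x := by
    induction x using FreeStar.induction with
    | scalar r => simp [starHom_scalar]
    | letter x => simp [starHom_letter]
    | mul a b ha hb => simp [ha, hb]
    | add a b ha hb => simp [ha, hb]
  star_mul a b := by simp
  star_add a b := by simp

theorem star_letter (x : Fin n ⊕ Fin n) : star (letter x) = letter x.swap := by
  change (starHom n (letter x)).unop = _
  rw [starHom_letter, MulOpposite.unop_op]

theorem star_scalar (r : ℂ) :
    star (algebraMap ℂ (FreeStar n) r) = algebraMap ℂ (FreeStar n) (star r) := by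
  change (starHom n _).unop = _
  rw [starHom_scalar, MulOpposite.unop_op]

instance : StarModule ℂ (FreeStar n) where
  star_smul r x := by
    rw [Algebra.smul_def, star_mul, star_scalar, Algebra.smul_def, Algebra.commutes]

theorem letter_inr (i : Fin n) : letter (Sum.inr i) = star (gen i) := by
  rw [gen, star_letter]; rfl

end FreeStar

open FreeStar

/-! ### The universal C⋆-norm -/

/-- `C⋆`-seminorms on the free `*`-algebra that vanish on the Cuntz relations
`(s i)⋆ * s j = δ i j` and `∑ i, s i * (s i)⋆ = 1`. -/
structure IsCuntzSeminorm (p : Seminorm ℂ (FreeStar n)) : Prop where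
  mul_le : ∀ x y, p (x * y) ≤ p x * p y
  star_mul_self : ∀ x, p (star x * x) = p x ^ 2
  orthonormal : ∀ i j, p (star (gen i) * gen j - if i = j then 1 else 0) = 0
  sum_range : p (∑ i, gen i * star (gen i) - 1) = 0

namespace IsCuntzSeminorm

variable {p : Seminorm ℂ (FreeStar n)}

theorem one_le (hp : IsCuntzSeminorm p) : p 1 ≤ 1 := by
  have h := hp.star_mul_self 1
  rw [star_one, one_mul] at h
  nlinarith [apply_nonneg p (1 : FreeStar n)]

theorem star_eq (hp : IsCuntzSeminorm p) (x : FreeStar n) : p (star x) = p x := by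
  have key : ∀ y : FreeStar n, p y ≤ p (star y) := fun y => by
    have h1 := hp.star_mul_self y
    have h2 := hp.mul_le (star y) y
    have h3 := apply_nonneg p y
    rcases h3.eq_or_lt with h | h
    · rw [← h]; exact apply_nonneg p _
    · nlinarith
  exact le_antisymm (by simpa using key (star x)) (key x)

theorem letter_le (hp : IsCuntzSeminorm p) (x : Fin n ⊕ Fin n) : p (letter x) ≤ 1 := by
  have key : ∀ i : Fin n, p (gen i) ≤ 1 := fun i => by
    have h1 := hp.star_mul_self (gen i)
    have h2 := hp.orthonormal i i
    rw [if_pos rfl] at h2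
    have h3 : p (star (gen i) * gen i) ≤ 1 := by
      calc p (star (gen i) * gen i) = p ((star (gen i) * gen i - 1) + 1) := by
            rw [sub_add_cancel]
        _ ≤ p (star (gen i) * gen i - 1) + p 1 := map_add_le_add p _ _
        _ ≤ 1 := by rw [h2, zero_add]; exact hp.one_le
    nlinarith [apply_nonneg p (gen i)]
  rcases x with i | i
  · exact key i
  · rw [letter_inr, hp.star_eq]; exact key i

end IsCuntzSeminorm

theorem exists_bound (x : FreeStar n) :
    ∃ C, ∀ p : Seminorm ℂ (FreeStar n), IsCuntzSeminorm p → p x ≤ C := by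
  induction x using FreeStar.induction with
  | scalar r =>
    refine ⟨‖r‖, fun p hp => ?_⟩
    rw [Algebra.algebraMap_eq_smul_one, map_smul_eq_mul]
    exact mul_le_of_le_one_right (norm_nonneg r) hp.one_le
  | letter x => exact ⟨1, fun p hp => hp.letter_le x⟩
  | mul a b ha hb =>
    obtain ⟨C, hC⟩ := ha
    obtain ⟨D, hD⟩ := hb
    refine ⟨C * D, fun p hp => (hp.mul_le a b).trans ?_⟩
    exact mul_le_mul (hC p hp) (hD p hp) (apply_nonneg p b) ((apply_nonneg p a).trans (hC p hp))
  | add a b ha hb =>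
    obtain ⟨C, hC⟩ := ha
    obtain ⟨D, hD⟩ := hb
    exact ⟨C + D, fun p hp => (map_add_le_add p a b).trans (add_le_add (hC p hp) (hD p hp))⟩

theorem isCuntzSeminorm_zero : IsCuntzSeminorm (0 : Seminorm ℂ (FreeStar n)) where
  mul_le _ _ := by simp
  star_mul_self _ := by simp
  orthonormal _ _ := by simp
  sum_range := by simp

/-- The universal `C⋆`-norm: the supremum of all `C⋆`-seminorms compatible with the Cuntz
relations. -/
def univNorm (x : FreeStar n) : ℝ :=
  ⨆ p : {p : Seminorm ℂ (FreeStar n) // IsCuntzSeminorm p}, p.1 x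

instance : Nonempty {p : Seminorm ℂ (FreeStar n) // IsCuntzSeminorm p} :=
  ⟨⟨0, isCuntzSeminorm_zero⟩⟩

theorem le_univNorm {p : Seminorm ℂ (FreeStar n)} (hp : IsCuntzSeminorm p) (x : FreeStar n) :
    p x ≤ univNorm x := by
  obtain ⟨C, hC⟩ := exists_bound x
  exact le_ciSup (f := fun p : {p : Seminorm ℂ (FreeStar n) // IsCuntzSeminorm p} => p.1 x)
    ⟨C, by rintro _ ⟨q, rfl⟩; exact hC q.1 q.2⟩ ⟨p, hp⟩

theorem univNorm_le {x : FreeStar n} {C : ℝ}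
    (h : ∀ p : Seminorm ℂ (FreeStar n), IsCuntzSeminorm p → p x ≤ C) : univNorm x ≤ C :=
  ciSup_le fun p => h p.1 p.2

theorem univNorm_nonneg (x : FreeStar n) : 0 ≤ univNorm x :=
  le_univNorm isCuntzSeminorm_zero x

theorem univNorm_add_le (x y : FreeStar n) : univNorm (x + y) ≤ univNorm x + univNorm y :=
  univNorm_le fun p hp => (map_add_le_add p x y).trans
    (add_le_add (le_univNorm hp x) (le_univNorm hp y))

theorem univNorm_mul_le (x y : FreeStar n) : univNorm (x * y) ≤ univNorm x * univNorm y :=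
  univNorm_le fun p hp => (hp.mul_le x y).trans
    (mul_le_mul (le_univNorm hp x) (le_univNorm hp y) (apply_nonneg p y) (univNorm_nonneg x))

theorem univNorm_neg (x : FreeStar n) : univNorm (-x) = univNorm x := by
  simp [univNorm]

theorem univNorm_zero : univNorm (0 : FreeStar n) = 0 := by
  simp [univNorm]

theorem univNorm_smul_le (c : ℂ) (x : FreeStar n) : univNorm (c • x) ≤ ‖c‖ * univNorm x :=
  univNorm_le fun p hp => by
    rw [map_smul_eq_mul]
    exact mul_le_mul_of_nonneg_left (le_univNorm hp x) (norm_nonneg c)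

theorem univNorm_star (x : FreeStar n) : univNorm (star x) = univNorm x :=
  congrArg iSup (funext fun p => p.2.star_eq x)

theorem sq_univNorm_le (x : FreeStar n) : univNorm x ^ 2 ≤ univNorm (star x * x) := by
  rw [← Real.le_sqrt (univNorm_nonneg _) (univNorm_nonneg _)]
  refine univNorm_le fun p hp => ?_
  rw [Real.le_sqrt (apply_nonneg p _) (univNorm_nonneg _), ← hp.star_mul_self]
  exact le_univNorm hp _

instance : SeminormedRing (FreeStar n) where
  __ := (inferInstance : Ring (FreeStar n))
  __ := AddGroupSeminorm.toSeminormedAddCommGroup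
    { toFun := univNorm
      map_zero' := univNorm_zero
      add_le' := univNorm_add_le
      neg' := univNorm_neg }
  norm_mul_le := univNorm_mul_le

theorem norm_def (x : FreeStar n) : ‖x‖ = univNorm x := rfl

instance : NormedAlgebra ℂ (FreeStar n) where
  norm_smul_le := univNorm_smul_le

/-! ### The Cuntz algebra -/

/-- The Cuntz algebra on `n` generators: the completion of the free `*`-algebra for the universal
`C⋆`-norm. -/
def CuntzAlgebra (n : ℕ) : Type := UniformSpace.Completion (FreeStar n)

namespace CuntzAlgebra

instance : NormedRing (CuntzAlgebra n) :=
  inferInstanceAs (NormedRing (UniformSpace.Completion (FreeStar n)))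

instance : CompleteSpace (CuntzAlgebra n) :=
  inferInstanceAs (CompleteSpace (UniformSpace.Completion (FreeStar n)))

instance : NormedAlgebra ℂ (CuntzAlgebra n) where
  __ := (inferInstance : Algebra ℂ (UniformSpace.Completion (FreeStar n)))
  norm_smul_le := fun c x =>
    norm_smul_le (β := UniformSpace.Completion (FreeStar n)) c x

/-- The canonical map of the free `*`-algebra to its completion. -/
def ofFree : FreeStar n →+* CuntzAlgebra n :=
  UniformSpace.Completion.coeRingHom (α := FreeStar n)

theorem denseRange_ofFree : DenseRange (ofFree (n := n)) :=
  UniformSpace.Completion.denseRange_coe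

theorem continuous_ofFree : Continuous (ofFree (n := n)) :=
  UniformSpace.Completion.continuous_coe _

theorem norm_ofFree (x : FreeStar n) : ‖ofFree x‖ = univNorm x :=
  UniformSpace.Completion.norm_coe x

theorem ofFree_smul (c : ℂ) (x : FreeStar n) : ofFree (c • x) = c • ofFree x :=
  UniformSpace.Completion.coe_smul c x

theorem isometry_star : Isometry (star : FreeStar n → FreeStar n) :=
  AddMonoidHomClass.isometry_of_norm (starAddEquiv (R := FreeStar n))
    fun x => univNorm_star x

instance : Star (CuntzAlgebra n) where
  star := UniformSpace.Completion.map (star : FreeStar n → FreeStar n)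

theorem continuous_star' : Continuous (star : CuntzAlgebra n → CuntzAlgebra n) :=
  UniformSpace.Completion.continuous_map

theorem star_ofFree (x : FreeStar n) : star (ofFree x) = ofFree (star x) :=
  UniformSpace.Completion.map_coe isometry_star.uniformContinuous x

@[elab_as_elim]
theorem induction_on {motive : CuntzAlgebra n → Prop} (x : CuntzAlgebra n)
    (closed : IsClosed {x | motive x}) (of : ∀ x, motive (ofFree x)) : motive x :=
  denseRange_ofFree.induction_on x closed of

@[elab_as_elim]
theorem induction_on₂ {motive : CuntzAlgebra n → CuntzAlgebra n → Prop} (x y : CuntzAlgebra n)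
    (closed : IsClosed {x : CuntzAlgebra n × CuntzAlgebra n | motive x.1 x.2})
    (of : ∀ x y, motive (ofFree x) (ofFree y)) : motive x y :=
  denseRange_ofFree.induction_on₂ closed of x y

instance : StarRing (CuntzAlgebra n) where
  star_involutive x := by
    induction x using induction_on with
    | closed => exact isClosed_eq (continuous_star'.comp continuous_star') continuous_id
    | of x => rw [star_ofFree, star_ofFree, star_star]
  star_mul x y := by
    induction x, y using induction_on₂ with
    | closed =>
      exact isClosed_eq (continuous_star'.comp continuous_mul)
        ((continuous_star'.comp continuous_snd).mul (continuous_star'.comp continuous_fst))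
    | of x y => rw [← map_mul, star_ofFree, star_mul, map_mul, star_ofFree, star_ofFree]
  star_add x y := by
    induction x, y using induction_on₂ with
    | closed =>
      exact isClosed_eq (continuous_star'.comp continuous_add)
        ((continuous_star'.comp continuous_fst).add (continuous_star'.comp continuous_snd))
    | of x y => rw [← map_add, star_ofFree, star_add, map_add, star_ofFree, star_ofFree]

instance : StarModule ℂ (CuntzAlgebra n) where
  star_smul c x := by
    induction x using induction_on with
    | closed =>
      exact isClosed_eq (continuous_star'.comp (continuous_const_smul c))
        (continuous_star'.const_smul (star c))
    | of x => rw [← ofFree_smul, star_ofFree, star_smul, ofFree_smul, star_ofFree]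

instance : CStarRing (CuntzAlgebra n) where
  norm_mul_self_le x := by
    induction x using induction_on with
    | closed =>
      exact isClosed_le (continuous_norm.mul continuous_norm)
        (continuous_norm.comp (continuous_star'.mul continuous_id))
    | of x =>
      rw [star_ofFree, ← map_mul, norm_ofFree, norm_ofFree, ← sq]
      exact sq_univNorm_le x

instance : CStarAlgebra (CuntzAlgebra n) where

instance : PartialOrder (CuntzAlgebra n) := CStarAlgebra.spectralOrder _

instance : StarOrderedRing (CuntzAlgebra n) := CStarAlgebra.spectralOrderedRing _

/-- The Cuntz generators. -/
def s (i : Fin n) : CuntzAlgebra n := ofFree (gen i)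

theorem ofFree_eq_zero {x : FreeStar n}
    (h : ∀ p : Seminorm ℂ (FreeStar n), IsCuntzSeminorm p → p x = 0) : ofFree x = 0 := by
  rw [← norm_eq_zero, norm_ofFree]
  exact le_antisymm (univNorm_le fun p hp => (h p hp).le) (univNorm_nonneg x)

theorem star_s_mul_s (i j : Fin n) :
    star (s i) * s j = if i = j then (1 : CuntzAlgebra n) else 0 := by
  have h : ofFree (star (gen i) * gen j - if i = j then 1 else 0) = (0 : CuntzAlgebra n) :=
    ofFree_eq_zero fun p hp => hp.orthonormal i j
  rw [map_sub, map_mul, sub_eq_zero, ← star_ofFree] at h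
  rw [s, s, h]
  split_ifs <;> simp

theorem sum_s_mul_star_s : ∑ i, s i * star (s i) = (1 : CuntzAlgebra n) := by
  have h : ofFree (∑ i, gen i * star (gen i) - 1) = (0 : CuntzAlgebra n) :=
    ofFree_eq_zero fun p hp => hp.sum_range
  rw [map_sub, sub_eq_zero, map_sum, map_one] at h
  rw [← h]
  exact Finset.sum_congr rfl fun i _ => by rw [map_mul, s, star_ofFree]

/-- The generators generate the Cuntz algebra as a `C⋆`-algebra. -/
theorem topologicalClosure_adjoin :
    (StarAlgebra.adjoin ℂ (Set.range (s (n := n)))).topologicalClosure = ⊤ := by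
  have key : ∀ x : FreeStar n, ofFree x ∈ StarAlgebra.adjoin ℂ (Set.range (s (n := n))) := by
    intro x
    induction x using FreeStar.induction with
    | scalar r =>
      rw [Algebra.algebraMap_eq_smul_one, ofFree_smul, map_one]
      exact SMulMemClass.smul_mem r (one_mem _)
    | letter x =>
      rcases x with i | i
      · exact StarAlgebra.subset_adjoin ℂ _ ⟨i, rfl⟩
      · rw [letter_inr, ← star_ofFree]
        exact star_mem (StarAlgebra.subset_adjoin ℂ _ ⟨i, rfl⟩)
    | mul a b ha hb => rw [map_mul]; exact mul_mem ha hb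
    | add a b ha hb => rw [map_add]; exact add_mem ha hb
  rw [eq_top_iff]
  rintro x -
  refine closure_mono ?_ (denseRange_ofFree x)
  rintro _ ⟨y, rfl⟩
  exact key y

/-- Universality: every family that satisfies the Cuntz relations in a unital `C⋆`-algebra is the
image of the generators under a unique unital `*`-homomorphism. -/
theorem existsUnique_hom {B : Type*} [CStarAlgebra B] (t : Fin n → B)
    (ht : ∀ i j, star (t i) * t j = if i = j then 1 else 0) (ht' : ∑ i, t i * star (t i) = 1) :
    ∃! φ : CuntzAlgebra n →⋆ₐ[ℂ] B, ∀ i, φ (s i) = t i := by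
  let ψ : FreeStar n →ₐ[ℂ] B := FreeAlgebra.lift ℂ (Sum.elim t fun i => star (t i))
  have hletter : ∀ x, ψ (letter x) = Sum.elim t (fun i => star (t i)) x :=
    fun x => FreeAlgebra.lift_ι_apply _ x
  have hgen : ∀ i, ψ (gen i) = t i := fun i => hletter (Sum.inl i)
  have hstar : ∀ x, ψ (star x) = star (ψ x) := by
    intro x
    induction x using FreeStar.induction with
    | scalar r => rw [star_scalar, AlgHom.commutes, AlgHom.commutes, algebraMap_star_comm]
    | letter x => rw [star_letter, hletter, hletter]; rcases x with i | i <;> simp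
    | mul a b ha hb => rw [star_mul, map_mul, map_mul, star_mul, ha, hb]
    | add a b ha hb => rw [star_add, map_add, map_add, star_add, ha, hb]
  let p : Seminorm ℂ (FreeStar n) := (normSeminorm ℂ B).comp ψ.toLinearMap
  have hp : ∀ x, p x = ‖ψ x‖ := fun x => rfl
  have hpC : IsCuntzSeminorm p :=
    { mul_le := fun x y => by rw [hp, hp, hp, map_mul]; exact norm_mul_le _ _
      star_mul_self := fun x => by
        rw [hp, hp, map_mul, hstar, CStarRing.norm_star_mul_self, sq]
      orthonormal := fun i j => by
        rw [hp, map_sub, map_mul, hstar, hgen, hgen, ht]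
        split_ifs <;> simp
      sum_range := by
        rw [hp, map_sub, map_sum, map_one]
        simp only [map_mul, hstar, hgen, ht', sub_self, norm_zero] }
  have hcont : Continuous ψ :=
    AddMonoidHomClass.continuous_of_bound ψ 1 fun x => by
      rw [one_mul, ← hp]; exact le_univNorm hpC x
  let Φ : CuntzAlgebra n →+* B :=
    UniformSpace.Completion.extensionHom (α := FreeStar n) ψ.toRingHom hcont
  have hΦ : ∀ x, Φ (ofFree x) = ψ x := fun x =>
    UniformSpace.Completion.extensionHom_coe (α := FreeStar n) ψ.toRingHom hcont x
  have hΦc : Continuous Φ := UniformSpace.Completion.continuous_extension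
  refine ⟨{ Φ with
      commutes' := fun r => ?_
      map_star' := fun x => ?_ }, fun i => ?_, fun χ hχ => ?_⟩
  · change Φ (algebraMap ℂ _ r) = _
    rw [Algebra.algebraMap_eq_smul_one, ← map_one (ofFree (n := n)), ← ofFree_smul, hΦ,
      ← Algebra.algebraMap_eq_smul_one, AlgHom.commutes]
  · change Φ (star x) = star (Φ x)
    induction x using induction_on with
    | closed => exact isClosed_eq (hΦc.comp continuous_star') hΦc.star
    | of x => rw [star_ofFree, hΦ, hΦ, hstar]
  · exact (hΦ _).trans (hgen i)
  · ext x
    change χ x = Φ x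
    have hχc : Continuous χ := AddMonoidHomClass.continuous_of_bound χ 1 fun x => by
      rw [one_mul]; exact NonUnitalStarAlgHom.norm_apply_le χ x
    refine denseRange_ofFree.induction_on x (isClosed_eq hχc hΦc) fun x => ?_
    rw [hΦ]
    induction x using FreeStar.induction with
    | scalar r =>
      rw [AlgHom.commutes, Algebra.algebraMap_eq_smul_one, ofFree_smul, map_one, map_smul,
        map_one, Algebra.algebraMap_eq_smul_one]
    | letter x =>
      rcases x with i | i
      · exact (hχ i).trans (hgen i).symm
      · rw [letter_inr, hstar, hgen, ← star_ofFree, map_star]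
        exact congrArg star (hχ i)
    | mul a b ha hb => rw [map_mul, map_mul, map_mul, ha, hb]
    | add a b ha hb => rw [map_add, map_add, map_add, ha, hb]

end CuntzAlgebra

open CuntzAlgebra

/-- The monomial `s_J = s_{j₁} ⋯ s_{jₗ}` for a word `J = (j₁, …, jₗ)`; the empty word gives `1`. -/
def monomial (J : List (Fin n)) : CuntzAlgebra n := (J.map s).prod

/-! ### States, their GNS representations, and the invariant `κ` -/

/-- States on the Cuntz algebra: positive linear functionals with value `1` at the unit. -/
structure State (n : ℕ) where
  toPositive : CuntzAlgebra n →ₚ[ℂ] ℂ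
  map_one : toPositive 1 = 1

namespace State

instance : CoeFun (State n) (fun _ => CuntzAlgebra n → ℂ) := ⟨fun ω => ω.toPositive⟩

/-- The Hilbert space of the GNS representation of `ω`. -/
abbrev H (ω : State n) : Type := ω.toPositive.GNS

/-- The GNS representation of `ω`. -/
def rep (ω : State n) : CuntzAlgebra n →⋆ₐ[ℂ] (ω.H →L[ℂ] ω.H) := ω.toPositive.gnsStarAlgHom

/-- The cyclic vector of the GNS representation of `ω`: the class of the unit. -/
def vac (ω : State n) : ω.H := ((ω.toPositive.toPreGNS 1 : ω.toPositive.PreGNS) : ω.H)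

/-- Two states are equivalent if their GNS representations are unitarily equivalent. -/
def Equivalent (ω ω' : State n) : Prop :=
  ∃ U : ω.H ≃ₗᵢ[ℂ] ω'.H, ∀ (a : CuntzAlgebra n) (x : ω.H), U (ω.rep a x) = ω'.rep a (U x)

/-- The closed linear span of the vectors `π(s_J)⋆ Ω`, over all words `J`, in the GNS space. -/
def corrSpace (ω : State n) : Submodule ℂ ω.H :=
  (Submodule.span ℂ (Set.range fun J : List (Fin n) =>
    ContinuousLinearMap.adjoint (ω.rep (monomial J)) ω.vac)).topologicalClosure

/-- The correlation dimension: the dimension of `corrSpace`, with value `⊤` if it is infinite. -/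
def cdim (ω : State n) : ℕ∞ := Cardinal.toENat (Module.rank ℂ ω.corrSpace)

/-- The least correlation dimension of a state that is equivalent to `ω`. The infimum is a minimum,
since `ℕ∞` is well-ordered and `ω` is equivalent to itself. -/
def kappa (ω : State n) : ℕ∞ := ⨅ ω' : {ω' : State n // ω'.Equivalent ω}, ω'.1.cdim

/-- A state is properly infinitely correlated if `κ(ω) = ∞`. -/
def IsProperlyInfinitelyCorrelated (ω : State n) : Prop := ω.kappa = ⊤

/-! ### Induced product states -/

/-- The number `z_J = z⁽¹⁾_{j₁} ⋯ z⁽ᵐ⁾_{jₘ}` for a word `J = (j₁, …, jₘ)`; the sequence is indexed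
from `0`, so that `z i` stands for `z⁽ⁱ⁺¹⁾`. -/
def wordCoeff (z : ℕ → EuclideanSpace ℂ (Fin n)) (J : List (Fin n)) : ℂ :=
  ∏ i : Fin J.length, z i (J.get i)

/-- `ω` is the induced product state by the sequence `z`. -/
def IsInducedProductState (z : ℕ → EuclideanSpace ℂ (Fin n)) (ω : State n) : Prop :=
  ∀ J K : List (Fin n), ω (monomial J * star (monomial K)) =
    if J.length = K.length then star (wordCoeff z J) * wordCoeff z K else 0

end State

end Cuntz

end

/-! Since `ω` vanishes on `s_J s_K⋆` for `|J| ≠ |K|`, it is gauge invariant, and its GNS space is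
the orthogonal Hilbert sum of pieces `V k`, `k ∈ ℤ`, each of which is mapped by every `π(s_i)⋆` into
`V (k - 1)`. By the Cuntz relation `∑ s_i s_i⋆ = 1`, the row of the `π(s_i)⋆` preserves the norm: `∑
‖π(s_i)⋆ x‖² = ‖x‖²`.

If an equivalent state `ω'` had finite correlation dimension, the vectors `π'(s_J)⋆ Ω'` would span a
finite-dimensional space that is invariant under all `π'(s_i)⋆` and contains `Ω' ≠ 0`. Its image `K`
in the GNS space of `ω` is excluded by `IsHilbertSum.eq_bot_of_shift_invariant`. Indeed, finite
dimension yields a finite set `S` of degrees and a constant `C` with `‖y‖² ≤ C ∑_{k ∈ S} ‖P_k y‖²`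
on `K` (`IsHilbertSum.exists_finset_norm_le`). Summing this over `y = π(s_J)⋆ x` with `|J| = m`
gives `‖x‖² ≤ C ∑_{k ∈ S} ‖P_{k+m} x‖²`. The right side tends to `0` as `m → ∞`, so `x = 0`. -/

/-! ### Orthogonal projections of a Hilbert sum. -/

section HilbertSum

variable {ι E : Type*} [NormedAddCommGroup E] [InnerProductSpace ℂ E] [CompleteSpace E]
  {V : ι → Submodule ℂ E} [∀ k, CompleteSpace (V k)]

/-- The projection to `V k` kills every `ℓ²` coordinate of `x` but the `k`-th, so that coordinate is
the projection of `x`. -/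
theorem IsHilbertSum.hasSum_starProjection
    (hV : IsHilbertSum ℂ (fun k => V k) fun k => (V k).subtypeₗᵢ) (x : E) :
    HasSum (fun k => (V k).starProjection x) x := by
  have h := hV.hasSum_linearIsometryEquiv_symm (hV.linearIsometryEquiv x)
  rw [LinearIsometryEquiv.symm_apply_apply] at h
  convert h using 2 with k
  have h' := h.mapL ((V k).starProjection)
  have h'' := hasSum_single (f := fun j => (V k).starProjection
    ((V j).subtypeₗᵢ (hV.linearIsometryEquiv x j))) k fun j hj => by
      rw [Submodule.starProjection_apply_eq_zero_iff]
      exact (hV.OrthogonalFamily.isOrtho hj) (Submodule.coe_mem _)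
  rw [h'.unique h'', Submodule.starProjection_eq_self_iff]
  exact Submodule.coe_mem _

theorem IsHilbertSum.summable_norm_sq_starProjection
    (hV : IsHilbertSum ℂ (fun k => V k) fun k => (V k).subtypeₗᵢ) (x : E) :
    Summable fun k => ‖(V k).starProjection x‖ ^ 2 :=
  (hV.OrthogonalFamily.summable_iff_norm_sq_summable
    fun k => (V k).orthogonalProjectionOnto x).1 (hV.hasSum_starProjection x).summable

/-- On a finite-dimensional subspace, finitely many of the summands of a Hilbert sum control the
norm. -/
theorem IsHilbertSum.exists_finset_norm_le
    (hV : IsHilbertSum ℂ (fun k => V k) fun k => (V k).subtypeₗᵢ)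
    (K : Submodule ℂ E) [FiniteDimensional ℂ K] :
    ∃ S : Finset ι, ∀ x ∈ K, ‖x‖ ≤ 2 * ∑ k ∈ S, ‖(V k).starProjection x‖ := by
  let b := stdOrthonormalBasis ℂ K
  set d : ℕ := Module.finrank ℂ K
  -- The `d` coefficients of `x` are at most `‖x‖`, so this tolerance keeps the total error below
  -- `‖x‖ / 2`; the `+ 1` covers `d = 0`.
  have hev : ∀ a : Fin d, ∀ᶠ S : Finset ι in Filter.atTop,
      ‖(b a : E) - ∑ k ∈ S, (V k).starProjection (b a)‖ < 1 / (2 * (d + 1)) := fun a => by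
    have h : Filter.Tendsto (fun S : Finset ι => ∑ k ∈ S, (V k).starProjection (b a : E))
      Filter.atTop (nhds (b a : E)) := hV.hasSum_starProjection _
    have h2 := Metric.tendsto_nhds.1 h (1 / (2 * (d + 1))) (by positivity)
    filter_upwards [h2] with S hS
    rwa [dist_eq_norm, norm_sub_rev] at hS
  obtain ⟨S, hS⟩ := (Filter.eventually_all.2 hev).exists
  refine ⟨S, fun x hx => ?_⟩
  have hxb : x = ∑ a, inner ℂ (b a) (⟨x, hx⟩ : K) • (b a : E) := by
    have := congrArg (Subtype.val) (b.sum_repr' ⟨x, hx⟩)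
    simpa using this.symm
  have hd : ‖x - ∑ k ∈ S, (V k).starProjection x‖ ≤ ‖x‖ / 2 := by
    have h1 : x - ∑ k ∈ S, (V k).starProjection x = ∑ a, inner ℂ (b a) (⟨x, hx⟩ : K) •
        ((b a : E) - ∑ k ∈ S, (V k).starProjection (b a)) := by
      have h2 : ∀ k, (V k).starProjection x =
          ∑ a, inner ℂ (b a) (⟨x, hx⟩ : K) • (V k).starProjection (b a) := fun k => by
        conv_lhs => rw [hxb]
        simp only [map_sum, map_smul]
      simp only [h2, smul_sub, Finset.sum_sub_distrib, ← hxb]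
      rw [Finset.sum_comm]
      simp only [Finset.smul_sum]
    rw [h1]
    calc _ ≤ ∑ a : Fin d, ‖x‖ * (1 / (2 * (d + 1))) := by
          refine norm_sum_le_of_le _ fun a _ => ?_
          rw [norm_smul]
          refine mul_le_mul ?_ (hS a).le (norm_nonneg _) (norm_nonneg _)
          simpa [b.orthonormal.1 a] using norm_inner_le_norm (𝕜 := ℂ) (b a) (⟨x, hx⟩ : K)
      _ = ‖x‖ / 2 * (d / (d + 1)) := by
          simp only [Finset.sum_const, Finset.card_univ, Fintype.card_fin, nsmul_eq_mul]
          field_simp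
      _ ≤ ‖x‖ / 2 := by
          refine mul_le_of_le_one_right (by positivity) ?_
          rw [div_le_one (by positivity)]
          linarith
  have h1 := norm_sum_le S fun k => (V k).starProjection x
  have h2 := norm_sub_norm_le x (∑ k ∈ S, (V k).starProjection x)
  linarith

end HilbertSum

/-! ### Operators that lower the degree of a `ℤ`-grading. -/

section Graded

variable {ι E : Type*} [Fintype ι] [NormedAddCommGroup E] [InnerProductSpace ℂ E] [CompleteSpace E]
  {V : ℤ → Submodule ℂ E} [∀ k, CompleteSpace (V k)]

/-- An operator that shifts a grading intertwines the projections to the graded pieces. -/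
theorem IsHilbertSum.starProjection_apply_of_shift
    (hV : IsHilbertSum ℂ (fun k => V k) fun k => (V k).subtypeₗᵢ) {T : E →L[ℂ] E}
    (hT : ∀ k, ∀ x ∈ V (k + 1), T x ∈ V k) (k : ℤ) (x : E) :
    (V k).starProjection (T x) = T ((V (k + 1)).starProjection x) := by
  -- In the expansion of `x` by degree, only the component of degree `k + 1` is sent by `T` into `V
  -- k`.
  have h := (hV.hasSum_starProjection x).mapL ((V k).starProjection ∘L T)
  have h' := hasSum_single (f := fun j => ((V k).starProjection ∘L T)
    ((V j).starProjection x)) (k + 1) fun j hj => by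
      have hj' : j - 1 ≠ k := fun h => hj (by omega)
      have hm : T ((V j).starProjection x) ∈ V (j - 1) :=
        hT _ _ (by rw [sub_add_cancel]; exact Submodule.starProjection_apply_mem _ _)
      rw [ContinuousLinearMap.comp_apply, Submodule.starProjection_apply_eq_zero_iff]
      exact (hV.OrthogonalFamily.isOrtho hj') hm
  refine (h.unique h').trans ?_
  exact Submodule.starProjection_eq_self_iff.2
    (hT k _ (Submodule.starProjection_apply_mem _ _))

/-- A row of operators that lowers the degree of a `ℤ`-graded Hilbert space by one and preserves
the norm admits no nonzero finite-dimensional invariant subspace. -/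
theorem IsHilbertSum.eq_bot_of_shift_invariant
    (hV : IsHilbertSum ℂ (fun k => V k) fun k => (V k).subtypeₗᵢ) {T : ι → E →L[ℂ] E}
    (hT : ∀ i k, ∀ x ∈ V (k + 1), T i x ∈ V k) (hnorm : ∀ x, ∑ i, ‖T i x‖ ^ 2 = ‖x‖ ^ 2)
    (K : Submodule ℂ E) [FiniteDimensional ℂ K] (hK : ∀ i, ∀ x ∈ K, T i x ∈ K) : K = ⊥ := by
  obtain ⟨S, hS⟩ := hV.exists_finset_norm_le K
  -- The square of the factor `2`, times the Cauchy–Schwarz constant of a sum over `S`.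
  set C : ℝ := 4 * S.card
  -- `S` and `C` depend on `K` alone, so the bound may be applied to each `T i x ∈ K` with no loss;
  -- summation over `i` then moves every degree up by one.
  have key : ∀ m : ℕ, ∀ x ∈ K,
      ‖x‖ ^ 2 ≤ C * ∑ k ∈ S, ‖(V (k + m)).starProjection x‖ ^ 2 := by
    intro m
    induction m with
    | zero =>
      intro x hx
      have h1 := pow_le_pow_left₀ (norm_nonneg x) (hS x hx) 2
      have h2 := sq_sum_le_card_mul_sum_sq (s := S) (f := fun k => ‖(V k).starProjection x‖)
      simp only [Nat.cast_zero, add_zero]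
      calc _ ≤ _ := h1
        _ ≤ _ := by rw [mul_pow]; simp only [C]; linarith
    | succ m ih =>
      intro x hx
      calc ‖x‖ ^ 2 = ∑ i, ‖T i x‖ ^ 2 := (hnorm x).symm
        _ ≤ ∑ i, C * ∑ k ∈ S, ‖(V (k + m)).starProjection (T i x)‖ ^ 2 :=
          Finset.sum_le_sum fun i _ => ih _ (hK i x hx)
        _ = C * ∑ k ∈ S, ∑ i, ‖T i ((V (k + m + 1)).starProjection x)‖ ^ 2 := by
          rw [← Finset.mul_sum, Finset.sum_comm]
          simp only [hV.starProjection_apply_of_shift (hT _)]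
        _ = _ := by
          simp only [hnorm, Nat.cast_add, Nat.cast_one, add_assoc]
  rw [Submodule.eq_bot_iff]
  intro x hx
  -- For fixed `k` the degrees `k + m` are distinct, so these are terms of a summable family.
  have hlim : Filter.Tendsto
      (fun m : ℕ => C * ∑ k ∈ S, ‖(V (k + m)).starProjection x‖ ^ 2) Filter.atTop (nhds 0) := by
    have h : ∀ k : ℤ, Filter.Tendsto (fun m : ℕ => ‖(V (k + m)).starProjection x‖ ^ 2)
        Filter.atTop (nhds 0) := fun k =>
      ((hV.summable_norm_sq_starProjection x).comp_injective
        (i := fun m : ℕ => k + m) fun a b h => by simpa using h).tendsto_atTop_zero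
    simpa using (tendsto_finsetSum S fun k _ => h k).const_mul C
  have h0 := ge_of_tendsto' hlim fun m => key m x hx
  have : ‖x‖ = 0 := by nlinarith [norm_nonneg x]
  exact norm_eq_zero.1 this

end Graded

noncomputable section

open scoped ComplexOrder

namespace Cuntz

variable {n : ℕ}

open CuntzAlgebra FreeStar

/-! ### Homogeneous elements of the Cuntz algebra. -/

@[simp] theorem monomial_nil : monomial ([] : List (Fin n)) = 1 := rfl

@[simp] theorem monomial_cons (i : Fin n) (J : List (Fin n)) :
    monomial (i :: J) = s i * monomial J := by
  simp [monomial]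

theorem monomial_append_singleton (J : List (Fin n)) (i : Fin n) :
    monomial (J ++ [i]) = monomial J * s i := by
  simp [monomial]

/-- The span of the monomials `s_J s_K⋆` with `|J| - |K| = k`. -/
def degreeSpace (n : ℕ) (k : ℤ) : Submodule ℂ (CuntzAlgebra n) :=
  Submodule.span ℂ {a | ∃ J K : List (Fin n),
    (J.length : ℤ) = K.length + k ∧ a = monomial J * star (monomial K)}

theorem monomial_mul_star_mem {J K : List (Fin n)} {k : ℤ} (h : (J.length : ℤ) = K.length + k) :
    monomial J * star (monomial K) ∈ degreeSpace n k :=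
  Submodule.subset_span ⟨J, K, h, rfl⟩

theorem one_mem_degreeSpace : (1 : CuntzAlgebra n) ∈ degreeSpace n 0 := by
  simpa using monomial_mul_star_mem (n := n) (J := []) (K := []) (k := 0) (by simp)

theorem s_mul_mem_degreeSpace (i : Fin n) {k : ℤ} {a : CuntzAlgebra n}
    (ha : a ∈ degreeSpace n k) : s i * a ∈ degreeSpace n (k + 1) := by
  induction ha using Submodule.span_induction with
  | mem a h =>
    obtain ⟨J, K, h, rfl⟩ := h
    rw [← mul_assoc, ← monomial_cons]
    exact monomial_mul_star_mem (by simp only [List.length_cons]; push_cast; omega)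
  | zero => rw [mul_zero]; exact zero_mem _
  | add a b _ _ ha hb => rw [mul_add]; exact add_mem ha hb
  | smul c a _ ha => rw [mul_smul_comm]; exact Submodule.smul_mem _ _ ha

/-- The Cuntz relation either cancels the first letter of `J` or gives zero; for empty `J` the
letter lengthens `K` instead. -/
theorem star_s_mul_mem_degreeSpace (i : Fin n) {k : ℤ} {a : CuntzAlgebra n}
    (ha : a ∈ degreeSpace n (k + 1)) : star (s i) * a ∈ degreeSpace n k := by
  induction ha using Submodule.span_induction with
  | mem a h =>
    obtain ⟨J, K, h, rfl⟩ := h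
    cases J with
    | nil =>
      rw [monomial_nil, one_mul, ← star_mul, ← monomial_append_singleton,
        ← one_mul (star _), ← monomial_nil]
      exact monomial_mul_star_mem (by simp at h ⊢; omega)
    | cons j J =>
      rw [monomial_cons, mul_assoc, ← mul_assoc, star_s_mul_s]
      split_ifs
      · rw [one_mul]
        exact monomial_mul_star_mem (by simp only [List.length_cons] at h; push_cast at h; omega)
      · rw [zero_mul]; exact zero_mem _
  | zero => rw [mul_zero]; exact zero_mem _
  | add a b _ _ ha hb => rw [mul_add]; exact add_mem ha hb
  | smul c a _ ha => rw [mul_smul_comm]; exact Submodule.smul_mem _ _ ha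

theorem monomial_mul_mem_degreeSpace (J : List (Fin n)) {k : ℤ} {a : CuntzAlgebra n}
    (ha : a ∈ degreeSpace n k) : monomial J * a ∈ degreeSpace n (k + J.length) := by
  induction J with
  | nil => simpa using ha
  | cons i J ih =>
    rw [monomial_cons, mul_assoc, List.length_cons, Nat.cast_add, Nat.cast_one, ← add_assoc]
    exact s_mul_mem_degreeSpace i ih

theorem star_monomial_mul_mem_degreeSpace (J : List (Fin n)) {k : ℤ} {a : CuntzAlgebra n}
    (ha : a ∈ degreeSpace n (k + J.length)) : star (monomial J) * a ∈ degreeSpace n k := by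
  induction J generalizing a with
  | nil => simpa using ha
  | cons i J ih =>
    rw [monomial_cons, star_mul, mul_assoc]
    refine ih (star_s_mul_mem_degreeSpace i ?_)
    rwa [List.length_cons, Nat.cast_add, Nat.cast_one, ← add_assoc] at ha

/-- This gives orthogonality of distinct degrees, as `⟪π(a)Ω, π(b)Ω⟫ = ω(a⋆b)`. For `a = s_J s_K⋆`,
the factor `s_J⋆` lowers the degree of `b` by `|J|` and `s_K` raises it by `|K|`. -/
theorem star_mul_mem_degreeSpace {k l : ℤ} {a b : CuntzAlgebra n}
    (ha : a ∈ degreeSpace n k) (hb : b ∈ degreeSpace n l) :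
    star a * b ∈ degreeSpace n (l - k) := by
  induction ha using Submodule.span_induction with
  | mem a h =>
    obtain ⟨J, K, h, rfl⟩ := h
    rw [star_mul, star_star, mul_assoc]
    have h1 : star (monomial J) * b ∈ degreeSpace n (l - J.length) :=
      star_monomial_mul_mem_degreeSpace J (by rwa [sub_add_cancel])
    have h2 := monomial_mul_mem_degreeSpace K h1
    rwa [show l - J.length + K.length = l - k by omega] at h2
  | zero => rw [star_zero, zero_mul]; exact zero_mem _
  | add a c _ _ ha hc => rw [star_add, add_mul]; exact add_mem ha hc
  | smul c a _ ha => rw [star_smul, smul_mul_assoc]; exact Submodule.smul_mem _ _ ha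

/-- The polynomials in the generators and their adjoints are sums of homogeneous elements. -/
theorem ofFree_mem_iSup_degreeSpace (x : FreeStar n) : ofFree x ∈ ⨆ k, degreeSpace n k := by
  -- As a statement on left multiplication, the claim passes to products by composition.
  suffices h : ∀ a ∈ ⨆ k, degreeSpace n k, ofFree x * a ∈ ⨆ k, degreeSpace n k by
    simpa using h 1 (Submodule.mem_iSup_of_mem 0 one_mem_degreeSpace)
  induction x using FreeStar.induction with
  | scalar r =>
    intro a ha
    rw [Algebra.algebraMap_eq_smul_one, ofFree_smul, map_one, smul_mul_assoc, one_mul]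
    exact Submodule.smul_mem _ _ ha
  | letter x =>
    intro a ha
    induction ha using Submodule.iSup_induction' with
    | mem k a ha =>
      rcases x with i | i
      · exact Submodule.mem_iSup_of_mem (k + 1) (s_mul_mem_degreeSpace i ha)
      · rw [letter_inr, ← star_ofFree]
        exact Submodule.mem_iSup_of_mem (k - 1)
          (star_s_mul_mem_degreeSpace i (by rwa [sub_add_cancel]))
    | zero => rw [mul_zero]; exact zero_mem _
    | add a b _ _ ha hb => rw [mul_add]; exact add_mem ha hb
  | mul x y hx hy =>
    intro a ha
    rw [map_mul, mul_assoc]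
    exact hx _ (hy _ ha)
  | add x y hx hy =>
    intro a ha
    rw [map_add, add_mul]
    exact add_mem (hx _ ha) (hy _ ha)

/-! ### The cyclic map to the GNS space and its inner products. -/

namespace State

variable (ω : State n)

/-- The map `a ↦ π(a) Ω` of the algebra to the GNS space. -/
def cyclicMap : CuntzAlgebra n →L[ℂ] ω.H :=
  (ContinuousLinearMap.apply ℂ ω.H ω.vac).comp
    (⟨ω.rep.toLinearMap, AddMonoidHomClass.continuous_of_bound ω.rep 1 fun x => by
      rw [one_mul]; exact NonUnitalStarAlgHom.norm_apply_le ω.rep x⟩)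

theorem cyclicMap_apply (a : CuntzAlgebra n) : ω.cyclicMap a = ω.rep a ω.vac := rfl

theorem cyclicMap_eq_coe (a : CuntzAlgebra n) :
    ω.cyclicMap a = ((ω.toPositive.toPreGNS a : ω.toPositive.PreGNS) : ω.H) := by
  refine (ω.toPositive.gnsNonUnitalStarAlgHom_apply_coe (a := a)).trans ?_
  rw [PositiveLinearMap.leftMulMapPreGNS_apply, PositiveLinearMap.ofPreGNS_toPreGNS, mul_one]

theorem rep_cyclicMap (a b : CuntzAlgebra n) : ω.rep a (ω.cyclicMap b) = ω.cyclicMap (a * b) := by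
  simp only [cyclicMap_apply, map_mul]; rfl

theorem inner_cyclicMap (a b : CuntzAlgebra n) :
    inner ℂ (ω.cyclicMap a) (ω.cyclicMap b) = ω (star a * b) := by
  rw [cyclicMap_eq_coe, cyclicMap_eq_coe, UniformSpace.Completion.inner_coe,
    PositiveLinearMap.preGNS_inner_def]
  rfl

theorem denseRange_cyclicMap : DenseRange ω.cyclicMap := by
  have h : ⇑ω.cyclicMap = (fun x : ω.toPositive.PreGNS => (x : ω.H)) ∘ ω.toPositive.toPreGNS :=
    funext ω.cyclicMap_eq_coe
  rw [h, DenseRange, ω.toPositive.toPreGNS.surjective.range_comp]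
  exact UniformSpace.Completion.denseRange_coe

theorem vac_ne_zero : ω.vac ≠ 0 := by
  intro h
  have h1 := ω.inner_cyclicMap 1 1
  rw [cyclicMap_apply, h, star_one, mul_one, ω.map_one] at h1
  simp at h1

theorem adjoint_rep (a : CuntzAlgebra n) :
    ContinuousLinearMap.adjoint (ω.rep a) = ω.rep (star a) := by
  rw [map_star, ContinuousLinearMap.star_eq_adjoint]

/-- Each summand is `⟪x, π(s_i s_i⋆) x⟫`, and `∑ s_i s_i⋆ = 1`. -/
theorem sum_norm_sq_rep_star_s (x : ω.H) : ∑ i, ‖ω.rep (star (s i)) x‖ ^ 2 = ‖x‖ ^ 2 := by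
  have h : ∀ i, (‖ω.rep (star (s i)) x‖ : ℂ) ^ 2 = inner ℂ x (ω.rep (s i * star (s i)) x) :=
    fun i => by
      rw [← RCLike.ofReal_eq_complex_ofReal, ← inner_self_eq_norm_sq_to_K]
      nth_rw 1 [← adjoint_rep, ContinuousLinearMap.adjoint_inner_left, map_mul]
      rfl
  have h2 : (∑ i, (‖ω.rep (star (s i)) x‖ : ℂ) ^ 2) = (‖x‖ : ℂ) ^ 2 := by
    simp only [h]
    rw [← inner_sum, ← sum_apply, ← map_sum, sum_s_mul_star_s, _root_.map_one]
    exact inner_self_eq_norm_sq_to_K (𝕜 := ℂ) x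
  exact_mod_cast h2

/-! ### The grading of the GNS space by degree. -/

/-- The closure of the vectors of degree `k` in the GNS space. -/
def gradedPiece (k : ℤ) : Submodule ℂ ω.H :=
  ((degreeSpace n k).map ω.cyclicMap.toLinearMap).topologicalClosure

instance (k : ℤ) : CompleteSpace (ω.gradedPiece k) :=
  (Submodule.isClosed_topologicalClosure _).completeSpace_coe

theorem rep_star_s_mem_gradedPiece (i : Fin n) (k : ℤ) {x : ω.H}
    (hx : x ∈ ω.gradedPiece (k + 1)) : ω.rep (star (s i)) x ∈ ω.gradedPiece k := by
  refine map_mem_closure (ω.rep (star (s i))).continuous hx ?_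
  rintro _ ⟨a, ha, rfl⟩
  exact ⟨_, star_s_mul_mem_degreeSpace i ha, (ω.rep_cyclicMap _ _).symm⟩

/-- Polynomials in the generators and their adjoints are dense in the algebra, their images are
dense in the GNS space, and each is a sum of homogeneous elements. -/
theorem iSup_gradedPiece_dense : ⊤ ≤ (⨆ k, ω.gradedPiece k).topologicalClosure := by
  rintro x -
  have hd := ω.denseRange_cyclicMap.comp denseRange_ofFree ω.cyclicMap.continuous
  refine closure_mono ?_ (hd x)
  rintro _ ⟨y, rfl⟩
  have h : (⨆ k, degreeSpace n k).map ω.cyclicMap.toLinearMap ≤ ⨆ k, ω.gradedPiece k := by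
    rw [Submodule.map_iSup]
    exact iSup_mono fun k => Submodule.le_topologicalClosure _
  exact h ⟨_, ofFree_mem_iSup_degreeSpace y, rfl⟩

/-- A state is gauge invariant if it vanishes on the homogeneous elements of nonzero degree. -/
def IsGaugeInvariant : Prop := ∀ k : ℤ, k ≠ 0 → ∀ a ∈ degreeSpace n k, ω a = 0

variable {ω}

theorem IsInducedProductState.isGaugeInvariant {z : ℕ → EuclideanSpace ℂ (Fin n)}
    (h : ω.IsInducedProductState z) : ω.IsGaugeInvariant := by
  intro k hk a ha
  induction ha using Submodule.span_induction with
  | mem a ha =>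
    obtain ⟨J, K, hJK, rfl⟩ := ha
    rw [h, if_neg (by omega)]
  | zero => exact map_zero ω.toPositive
  | add a b _ _ ha hb => exact (map_add ω.toPositive a b).trans (by rw [ha, hb, add_zero])
  | smul c a _ ha => exact (map_smul ω.toPositive c a).trans (by rw [ha, smul_zero])

/-- The GNS space of a gauge-invariant state is graded by degree. -/
theorem IsGaugeInvariant.isHilbertSum (h : ω.IsGaugeInvariant) :
    IsHilbertSum ℂ (fun k => ω.gradedPiece k) fun k => (ω.gradedPiece k).subtypeₗᵢ := by
  refine IsHilbertSum.mkInternal _ (OrthogonalFamily.of_pairwise fun k l hkl => ?_)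
    ω.iSup_gradedPiece_dense
  -- Orthogonal complements are closed and do not see closures, so it suffices to compare vectors
  -- `π(a)Ω` and `π(b)Ω` with `a`, `b` homogeneous.
  rw [Function.onFun, gradedPiece, gradedPiece, Submodule.IsOrtho, Submodule.orthogonal_closure]
  refine Submodule.topologicalClosure_minimal _ ?_ (Submodule.isClosed_orthogonal _)
  rintro _ ⟨a, ha, rfl⟩
  refine (Submodule.mem_orthogonal' _ _).2 ?_
  rintro _ ⟨b, hb, rfl⟩
  exact (ω.inner_cyclicMap a b).trans
    (h (l - k) (sub_ne_zero.2 hkl.symm) _ (star_mul_mem_degreeSpace ha hb))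

/-- Every gauge-invariant state is properly infinitely correlated. -/
theorem IsGaugeInvariant.isProperlyInfinitelyCorrelated (h : ω.IsGaugeInvariant) :
    ω.IsProperlyInfinitelyCorrelated := by
  rw [IsProperlyInfinitelyCorrelated, kappa, iInf_eq_top]
  rintro ⟨ω', U, hU⟩
  by_contra hfin
  rw [cdim, ← ne_eq, ← lt_top_iff_ne_top, Cardinal.toENat_lt_top, Module.rank_lt_aleph0_iff] at hfin
  let W : Submodule ℂ ω'.H := Submodule.span ℂ (Set.range fun J : List (Fin n) =>
    ContinuousLinearMap.adjoint (ω'.rep (monomial J)) ω'.vac)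
  replace hfin : Module.Finite ℂ W.topologicalClosure := hfin
  have hWfin : FiniteDimensional ℂ W :=
    FiniteDimensional.of_injective (Submodule.inclusion (Submodule.le_topologicalClosure W))
      (Submodule.inclusion_injective _)
  have hWinv : ∀ i, ∀ x ∈ W, ω'.rep (star (s i)) x ∈ W := by
    intro i x hx
    induction hx using Submodule.span_induction with
    | mem x hx =>
      obtain ⟨J, rfl⟩ := hx
      -- Adjoints reverse products, `π(s_i)⋆ π(s_J)⋆ = π(s_J s_i)⋆`, so the new letter goes at the
      -- end of `J`.
      refine Submodule.subset_span ⟨J ++ [i], ?_⟩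
      change ContinuousLinearMap.adjoint (ω'.rep (monomial (J ++ [i]))) ω'.vac =
        ω'.rep (star (s i)) (ContinuousLinearMap.adjoint (ω'.rep (monomial J)) ω'.vac)
      rw [adjoint_rep, adjoint_rep, monomial_append_singleton, star_mul, map_mul]
      rfl
    | zero => rw [map_zero]; exact zero_mem _
    | add x y _ _ hx hy => rw [map_add]; exact add_mem hx hy
    | smul c x _ hx => rw [map_smul]; exact Submodule.smul_mem _ _ hx
  -- `ω'` need not be gauge invariant, so `W` is carried by `U` to the GNS space of `ω`, where the
  -- grading lives.
  have hbot := h.isHilbertSum.eq_bot_of_shift_invariant (T := fun i => ω.rep (star (s i)))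
    (fun i k x hx => ω.rep_star_s_mem_gradedPiece i k hx) ω.sum_norm_sq_rep_star_s
    (W.map U.toLinearEquiv.toLinearMap) (by
      rintro i _ ⟨x, hx, rfl⟩
      exact ⟨_, hWinv i x hx, hU _ _⟩)
  -- The empty word contributes the cyclic vector itself.
  have hvac : ω'.vac ∈ W := Submodule.subset_span ⟨[], by
    change ContinuousLinearMap.adjoint (ω'.rep (monomial [])) ω'.vac = ω'.vac
    rw [adjoint_rep, monomial_nil, star_one, _root_.map_one, one_apply_eq_self]⟩
  have h0 : U ω'.vac ∈ (⊥ : Submodule ℂ ω.H) := hbot ▸ ⟨_, hvac, rfl⟩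
  rw [Submodule.mem_bot, LinearIsometryEquiv.map_eq_zero_iff] at h0
  exact ω'.vac_ne_zero h0

end State

end Cuntz

end

theorem proposition3p10 (n : ℕ) (hn : 2 ≤ n)
    (z : ℕ → EuclideanSpace ℂ (Fin n)) (hz : ∀ i, ‖z i‖ = 1)
    (ω : Cuntz.State n) (hω : ω.IsInducedProductState z) :
    ω.IsProperlyInfinitelyCorrelated :=
  hω.isGaugeInvariant.isProperlyInfinitelyCorrelated
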